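/- Let $d$ be a positive integer, let $F\subseteq\mathbb{Z}^d$ be a finite set with $|F|=k\ge 3$, and let $\mu$ be a real number with $0<\mu<\frac{k-1}{k}$. Call a set $F'\subseteq\mathbb{Z}^d$ a homothetic copy of $F$ if $F'=v+\lambda F=\{v+\lambda f : f\in F\}$ for some $v\in\mathbb{Z}^d$ and some positive integer $\lambda$. Call a set $Z\subseteq\mathbb{Z}^d$ $F$-free if there is no nonzero real $\lambda$ such that $Z$ contains a congruent copy of $\lambda F$, that is, a subset admitting a bijection onto $\lambda F=\{\lambda f : f\in F\}\subseteq\mathbb{R}^d$ that preserves Euclidean distances. Then there is a set $X\subseteq\mathbb{N}^d$ of lattice points, where $\mathbb{N}=\{1,2,3,\dots\}$, depending only on $F$ and $\mu$, such that (i) for every integer $r\ge 1$, every $r$-colouring of $X$ contains a monochromatic homothetic copy of $F$; (ii) every finite subset $Y\subseteq X$ has an $F$-free subset $Z\subseteq Y$ of size $|Z|\ge\mu|Y|$. -/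

import Mathlib

open scoped Pointwise

/-- The inclusion of the integer lattice `ℤ^d` into Euclidean space `ℝ^d`. -/
def latticeToEuclidean {d : ℕ} (x : Fin d → ℤ) : EuclideanSpace ℝ (Fin d) :=
  WithLp.toLp 2 (fun i => (x i : ℝ))

/-- `F'` is a homothetic copy of `F`: it is `v + l F` for a lattice vector `v`
and a positive integer `l`. -/
def IsHomotheticCopy {d : ℕ} (F F' : Set (Fin d → ℤ)) : Prop :=
  ∃ (v : Fin d → ℤ) (l : ℤ), 0 < l ∧ F' = (fun f => v + l • f) '' F

/-- Two point sets are congruent if there is a distance-preserving bijection between them. -/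
def SetsCongruent {E : Type*} [PseudoEMetricSpace E] (A B : Set E) : Prop :=
  ∃ e : A ≃ B, Congruent (fun a : A => (a : E)) (fun a : A => (e a : E))

/-- `Z` is `F`-free: for no nonzero real `c` does `Z` contain a congruent copy of `c F`,
where congruence and scaling are those of Euclidean space. -/
def IsConfigFree {d : ℕ} (F Z : Set (Fin d → ℤ)) : Prop :=
  ¬ ∃ c : ℝ, c ≠ 0 ∧ ∃ W : Set (EuclideanSpace ℝ (Fin d)),
    W ⊆ latticeToEuclidean '' Z ∧ SetsCongruent W (c • (latticeToEuclidean '' F))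

/-!
Let `k` be the number of points of the pattern. Under a random ranking of a ground set, the peak of
a window of length `m` is equally likely to sit at each position, so with probability close to
`(k - 1) / k` it sits at a good one: not divisible by `k` and not among the last `k`. But `k`
consecutive windows of a sequence never all have good peaks: if `t` is the peak of the first, then
the window shifted by `t % k` has its peak at `t - t % k`, a multiple of `k`. By Ramsey's theorem
every finite colouring of the windows is constant on some `k` consecutive ones.

Crossing this hypergraph with Hales–Jewett lines, every edge is carried onto a homothetic copy of
the pattern, and the partite construction of Nešetřil and Rödl turns it into a finite point set in
which every similar copy of the pattern lies over an edge. Averaging over the rankings then gives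
the density bound, while the colouring property survives. Finally, such sets for all numbers of
colours are placed far apart, so that no similar copy of the pattern meets two of them.
-/

open Combinatorics Filter Function

section Similarity

variable {L α ι : Type*} [AddCommGroup L] {Q : QuadraticForm ℤ L} {f q : α → L}

/-- `q` is a similar copy of the pattern `f` with respect to the squared distance `Q (x - y)`. The
ratio of squared distances is eliminated, so that constant maps count as degenerate similar
copies. -/
def IsSimilarity (Q : QuadraticForm ℤ L) (f q : α → L) : Prop :=
  ∀ a b a' b', Q (q a - q b) * Q (f a' - f b') = Q (q a' - q b') * Q (f a - f b)

/-- `g` is a homothetic copy of the pattern `f`, with positive integer ratio. -/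
def IsHomothety (f g : α → L) : Prop :=
  ∃ (v : L) (l : ℤ), 0 < l ∧ ∀ a, g a = v + l • f a

lemma isSimilarity_const (c : L) : IsSimilarity Q f fun _ => c := by
  simp [IsSimilarity]

lemma isSimilarity_const_add_iff (c : L) :
    IsSimilarity Q f (fun a => c + q a) ↔ IsSimilarity Q f q := by
  simp only [IsSimilarity, add_sub_add_left_eq_sub]

lemma IsSimilarity.const_of_eq (hQ : Q.Anisotropic) (hf : Injective f) (hq : IsSimilarity Q f q)
    {a b : α} (hab : a ≠ b) (h : q a = q b) (a' b' : α) : q a' = q b' := by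
  have hprod : 0 = Q (q a' - q b') * Q (f a - f b) := by simpa [h] using hq a b a' b'
  have hab' : Q (f a - f b) ≠ 0 := fun h0 => hab (hf (sub_eq_zero.1 (hQ _ h0)))
  exact sub_eq_zero.1 (hQ _ ((mul_eq_zero.1 hprod.symm).resolve_right hab'))

lemma IsSimilarity.const_or_injective (hQ : Q.Anisotropic) (hf : Injective f)
    (hq : IsSimilarity Q f q) : (∀ a b, q a = q b) ∨ Injective q := by
  refine or_iff_not_imp_right.2 fun hinj => ?_
  obtain ⟨a, b, hqab, hab⟩ := not_injective_iff.1 hinj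
  exact hq.const_of_eq hQ hf hab hqab

lemma IsHomothety.refl (f : α → L) : IsHomothety f f :=
  ⟨0, 1, one_pos, by simp⟩

lemma IsHomothety.const_add {g : α → L} (hg : IsHomothety f g) (c : L) :
    IsHomothety f fun a => c + g a := by
  obtain ⟨v, l, hl, hg⟩ := hg
  exact ⟨c + v, l, hl, fun a => by simp only [hg, add_assoc]⟩

lemma IsHomothety.injective {g : α → L} (hQ : Q.Anisotropic) (hf : Injective f)
    (hg : IsHomothety f g) : Injective g := by
  obtain ⟨v, l, hl, hg⟩ := hg
  intro a b hab
  have hscaled : l • (f a - f b) = 0 := by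
    rw [smul_sub, sub_eq_zero]
    simpa only [hg, add_right_inj] using hab
  have hnorm : l * l * Q (f a - f b) = 0 := by
    rw [← smul_eq_mul, ← Q.map_smul, hscaled, Q.map_zero]
  exact hf (sub_eq_zero.1 (hQ _ ((mul_eq_zero.1 hnorm).resolve_left (mul_pos hl hl).ne')))

lemma IsHomothety.sum_smul [Fintype ι] {w : ι → ℤ} (hw : ∀ i, 0 < w i) {g : ι → α → L}
    (hg : ∀ i, IsHomothety f (g i) ∨ ∃ c, ∀ a, g i a = c) {i₀ : ι} (hi₀ : IsHomothety f (g i₀)) :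
    IsHomothety f fun a => ∑ i, w i • g i a := by
  have hcoeff : ∀ i, ∃ (v : L) (l : ℤ), 0 ≤ l ∧ (IsHomothety f (g i) → 0 < l) ∧
      ∀ a, g i a = v + l • f a := fun i => by
    by_cases hi : IsHomothety f (g i)
    · obtain ⟨v, l, hl, hg⟩ := hi
      exact ⟨v, l, hl.le, fun _ => hl, hg⟩
    · obtain ⟨c, hc⟩ := (hg i).resolve_left hi
      exact ⟨c, 0, le_rfl, fun h => absurd h hi, by simpa using hc⟩
  choose v l hl hpos hg using hcoeff
  refine ⟨∑ i, w i • v i, ∑ i, w i * l i, ?_, fun a => ?_⟩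
  · exact Finset.sum_pos' (fun i _ => mul_nonneg (hw i).le (hl i))
      ⟨i₀, Finset.mem_univ _, mul_pos (hw i₀) (hpos i₀ hi₀)⟩
  · simp only [hg, smul_add, Finset.sum_add_distrib, Finset.sum_smul, mul_smul]

end Similarity

section ThreePoints

variable {α : Type*} [Fintype α]

lemma exists_ne_ne (hα : 3 ≤ Fintype.card α) (a b : α) : ∃ c, c ≠ a ∧ c ≠ b := by
  classical
  obtain ⟨c, -, hc⟩ := Finset.exists_mem_notMem_of_card_lt_card
    (s := {a, b}) (t := Finset.univ) (Finset.card_le_two.trans_lt hα)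
  exact ⟨c, by simpa using hc⟩

lemma exists_ne_map_eq_of_forall_eq_or_eq {X : Type*} (hα : 3 ≤ Fintype.card α) {g : α → X}
    {y z : X} (hg : ∀ a, g a = y ∨ g a = z) : ∃ a b, a ≠ b ∧ g a = g b := by
  classical
  obtain ⟨a, -, b, -, h⟩ := Finset.exists_ne_map_eq_of_card_lt_of_maps_to
    (s := Finset.univ) (t := {y, z}) (Finset.card_le_two.trans_lt hα)
    (f := g) fun a _ => by simpa using hg a
  exact ⟨a, b, h⟩

end ThreePoints

section GeneralPosition

variable {L α : Type*} [AddCommGroup L] {Q : QuadraticForm ℤ L} {f : α → L}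

lemma eventually_quadratic_eq_zero (a b c : ℤ) :
    ∀ᶠ N : ℤ in atTop, a + b * N + c * N ^ 2 = 0 → a = 0 ∧ c = 0 := by
  let p : Cubic ℤ := ⟨0, c, b, a⟩
  by_cases hp : p.toPoly = 0
  · exact .of_forall fun N _ => ⟨by simpa [hp] using (p.coeff_eq_d).symm,
      by simpa [hp] using (p.coeff_eq_b).symm⟩
  · filter_upwards [atTop_le_cofinite
      (Polynomial.finite_setOfPred_isRoot hp).eventually_cofinite_notMem] with N hN hroot
    suffices c * N ^ 2 + b * N + a = 0 from
      absurd (by simpa [p, Cubic.toPoly, Polynomial.IsRoot] using this) hN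
    linear_combination hroot

lemma map_smul_add_eq_quadratic (Q : QuadraticForm ℤ L) (N : ℤ) (x y : L) :
    Q (N • x + y) = Q y + QuadraticMap.polar Q x y * N + Q x * N ^ 2 := by
  rw [QuadraticMap.map_add Q, Q.map_smul, Q.polar_smul_left, smul_eq_mul, smul_eq_mul]
  ring

lemma eventually_isSimilarity_of_smul_add [Finite α] (p q : α → L) : ∀ᶠ N : ℤ in atTop,
    IsSimilarity Q f (fun a => N • p a + q a) → IsSimilarity Q f p ∧ IsSimilarity Q f q := by
  have hcoeff : ∀ᶠ N : ℤ in atTop, ∀ a b a' b',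
      Q (N • (p a - p b) + (q a - q b)) * Q (f a' - f b') =
        Q (N • (p a' - p b') + (q a' - q b')) * Q (f a - f b) →
      Q (p a - p b) * Q (f a' - f b') = Q (p a' - p b') * Q (f a - f b) ∧
        Q (q a - q b) * Q (f a' - f b') = Q (q a' - q b') * Q (f a - f b) := by
    simp only [eventually_all]
    intro a b a' b'
    filter_upwards [eventually_quadratic_eq_zero
      (Q (q a - q b) * Q (f a' - f b') - Q (q a' - q b') * Q (f a - f b))
      (QuadraticMap.polar Q (p a - p b) (q a - q b) * Q (f a' - f b') -
        QuadraticMap.polar Q (p a' - p b') (q a' - q b') * Q (f a - f b))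
      (Q (p a - p b) * Q (f a' - f b') - Q (p a' - p b') * Q (f a - f b))] with N hN h
    simp only [map_smul_add_eq_quadratic] at h
    obtain ⟨hq, hp⟩ := hN (by linear_combination h)
    exact ⟨sub_eq_zero.1 hp, sub_eq_zero.1 hq⟩
  filter_upwards [hcoeff] with N hN h
  have hsplit := fun a b a' b' => hN a b a' b' (by
    simpa only [smul_sub, ← add_sub_add_comm] using h a b a' b')
  exact ⟨fun a b a' b' => (hsplit a b a' b').1, fun a b a' b' => (hsplit a b a' b').2⟩

/-- The weights `w` put the words over the alphabet `T` in general position: a similar copy of `f`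
formed by the weighted sums of words is a similar copy in every single coordinate. -/
def IsGeneric {ι : Type*} [Fintype ι] (Q : QuadraticForm ℤ L) (f : α → L) (T : Set L)
    (w : ι → ℤ) : Prop :=
  ∀ u : α → ι → L, (∀ a i, u a i ∈ T) → IsSimilarity Q f (fun a => ∑ i, w i • u a i) →
    ∀ i, IsSimilarity Q f fun a => u a i

lemma exists_isGeneric_option [Finite α] {ι : Type*} [Fintype ι] {T : Set L} (hT : T.Finite)
    {w : ι → ℤ} (hw : IsGeneric Q f T w) :
    ∃ N : ℤ, 0 < N ∧ IsGeneric Q f T fun i : Option ι => i.elim N w := by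
  have := hT.to_subtype
  have hsplit : ∀ᶠ N : ℤ in atTop, ∀ u : α → Option ι → T,
      IsSimilarity Q f (fun a => N • (u a none : L) + ∑ i, w i • (u a (some i) : L)) →
      IsSimilarity Q f (fun a => (u a none : L)) ∧
        IsSimilarity Q f fun a => ∑ i, w i • (u a (some i) : L) :=
    eventually_all.2 fun u => eventually_isSimilarity_of_smul_add _ _
  obtain ⟨N, hN, hN0⟩ := (hsplit.and (eventually_gt_atTop 0)).exists
  refine ⟨N, hN0, fun u hu hsim => ?_⟩
  simp only [Fintype.sum_option, Option.elim] at hsim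
  obtain ⟨hnone, hsome⟩ := hN (fun a i => ⟨u a i, hu a i⟩) hsim
  rintro (_ | i)
  · exact hnone
  · exact hw (fun a i => u a (some i)) (fun a i => hu a _) hsome i

lemma exists_isGeneric [Finite α] (ι : Type*) [Fintype ι] {T : Set L} (hT : T.Finite) :
    ∃ w : ι → ℤ, (∀ i, 0 < w i) ∧ IsGeneric Q f T w := by
  refine Fintype.induction_empty_option
    (P := fun ι _ => ∃ w : ι → ℤ, (∀ i, 0 < w i) ∧ IsGeneric Q f T w) ?_ ?_ ?_ ι
  · rintro ι κ _ e ⟨w, hw0, hw⟩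
    let _ : Fintype ι := Fintype.ofEquiv κ e.symm
    refine ⟨w ∘ e.symm, fun i => hw0 _, fun u hu hsim i => ?_⟩
    have := hw (fun a => u a ∘ e) (fun a i => hu a _) (by
      convert hsim using 2 with a
      exact Fintype.sum_equiv e _ _ fun i => by simp) (e.symm i)
    simpa using this
  · exact ⟨1, fun i => i.elim, fun _ _ _ i => i.elim⟩
  · rintro ι _ ⟨w, hw0, hw⟩
    obtain ⟨N, hN0, hN⟩ := exists_isGeneric_option hT hw
    exact ⟨_, Option.rec hN0 hw0, hN⟩

lemma IsGeneric.eq_of_sum_smul_eq [Fintype α] (hα : 3 ≤ Fintype.card α) (hQ : Q.Anisotropic)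
    (hf : Injective f) {ι : Type*} [Fintype ι] {T : Set L} {w : ι → ℤ} (hw : IsGeneric Q f T w)
    {u u' : ι → L} (hu : ∀ i, u i ∈ T) (hu' : ∀ i, u' i ∈ T)
    (h : ∑ i, w i • u i = ∑ i, w i • u' i) : u = u' := by
  classical
  obtain ⟨a, b, c, hab, hac, hbc⟩ := Fintype.two_lt_card_iff.1 hα
  have hsim := hw (update (fun _ => u') a u)
    (fun x i => by rcases eq_or_ne x a with rfl | hx <;> simp [*]) (by
      convert isSimilarity_const (∑ i, w i • u' i) using 2 with x
      rcases eq_or_ne x a with rfl | hx <;> simp [*])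
  funext i
  simpa [hab.symm] using (hsim i).const_of_eq hQ hf hbc (by simp [hab.symm, hac.symm]) a b

end GeneralPosition

section Separation

variable {L α : Type*} [AddCommGroup L] {Q : QuadraticForm ℤ L} {f : α → L}

/-- The point sets `A` and `B` are disjoint, and no similar copy of `f` uses points of both. -/
def SimilaritySeparated (Q : QuadraticForm ℤ L) (f : α → L) (A B : Set L) : Prop :=
  Disjoint A B ∧
    ∀ q, IsSimilarity Q f q → (∀ a, q a ∈ A ∪ B) → (∀ a, q a ∈ A) ∨ ∀ a, q a ∈ B

lemma eventually_map_sub_smul_add_mul_ne (hQ : Q.Anisotropic) {v : L} (hv : v ≠ 0) {c : ℤ}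
    (hc : c ≠ 0) (x y : L) (D : ℤ) : ∀ᶠ N : ℤ in atTop, Q (x - (N • v + y)) * c ≠ D := by
  filter_upwards [eventually_quadratic_eq_zero (Q (y - x) * c - D)
    (QuadraticMap.polar Q v (y - x) * c) (Q v * c)] with N hN h
  rw [QuadraticMap.map_sub, add_sub_assoc, map_smul_add_eq_quadratic] at h
  exact mul_ne_zero (fun h0 => hv (hQ v h0)) hc (hN (by linear_combination h)).2

lemma eventually_similaritySeparated [Fintype α] (hα : 3 ≤ Fintype.card α) (hQ : Q.Anisotropic)
    (hf : Injective f) {A B : Set L} (hA : A.Finite) (hB : B.Finite) {v : L} (hv : v ≠ 0) :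
    ∀ᶠ N : ℤ in atTop, SimilaritySeparated Q f A (N • v +ᵥ B) := by
  have := hA.to_subtype
  have := hB.to_subtype
  have hnorm : ∀ {a b : α}, a ≠ b → Q (f a - f b) ≠ 0 := fun hab h =>
    hab (hf (sub_eq_zero.1 (hQ _ h)))
  have hfarA : ∀ᶠ N : ℤ in atTop, ∀ (a b c : α) (_ : a ≠ c) (x x' : A) (y : B),
      Q ((x : L) - (N • v + y)) * Q (f a - f c) ≠ Q ((x : L) - x') * Q (f a - f b) := by
    simp only [eventually_all]
    exact fun a b c hac x x' y => eventually_map_sub_smul_add_mul_ne hQ hv (hnorm hac) _ _ _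
  have hfarB : ∀ᶠ N : ℤ in atTop, ∀ (a b c : α) (_ : b ≠ c) (x : A) (y y' : B),
      Q ((x : L) - (N • v + y)) * Q (f b - f c) ≠ Q ((y : L) - y') * Q (f a - f b) := by
    simp only [eventually_all]
    exact fun a b c hbc x y y' => eventually_map_sub_smul_add_mul_ne hQ hv (hnorm hbc) _ _ _
  filter_upwards [hfarA, hfarB] with N hNA hNB
  refine ⟨Set.disjoint_left.2 fun x hx hxB => ?_, fun q hq hmem => ?_⟩
  · obtain ⟨a, b, hab⟩ := Fintype.exists_pair_of_one_lt_card (by lia : 1 < Fintype.card α)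
    obtain ⟨y, hy, rfl⟩ := hxB
    exact hNA a a b hab ⟨_, hx⟩ ⟨_, hx⟩ ⟨y, hy⟩ (by simp)
  · by_contra! h
    obtain ⟨⟨b, hbA⟩, a, haB⟩ := h
    obtain ⟨c, hca, hcb⟩ := exists_ne_ne hα a b
    have ha := (hmem a).resolve_right haB
    obtain ⟨y, hy, hqb⟩ := (hmem b).resolve_left hbA
    rcases hmem c with hc | ⟨y', hy', hqc⟩
    · exact hNA a b c hca.symm ⟨_, ha⟩ ⟨_, hc⟩ ⟨y, hy⟩ (by simpa [← hqb] using hq a b a c)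
    · exact hNB a b c hcb.symm ⟨_, ha⟩ ⟨y, hy⟩ ⟨y', hy'⟩
        (by simpa [← hqb, ← hqc] using hq a b b c)

end Separation

section Pictures

variable {L α V : Type*} [AddCommGroup L] {Q : QuadraticForm ℤ L} {f : α → L}

/-- The finite point set `P`, projected by `π` to the vertex set `V`, is a picture of the
hypergraph with edges (the ranges of) `E`: every nondegenerate similar copy of `f` in `P` projects
onto an edge. -/
structure IsPicture (Q : QuadraticForm ℤ L) (f : α → L) (E : Set (α → V)) (P : Set L)
    (π : L → V) : Prop where
  finite : P.Finite
  const_or_edge : ∀ q, IsSimilarity Q f q → (∀ a, q a ∈ P) →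
    (∀ a b, q a = q b) ∨ ∃ e ∈ E, Set.range (π ∘ q) = Set.range e

/-- However the points are coloured from `K`, the edges of `E` are the projections of homothetic
copies of `f` in `P` on which, over the vertices of `S`, the colour depends on the vertex only. -/
def PictureArrow (K : Type*) (f : α → L) (E : Set (α → V)) (P : Set L) (π : L → V)
    (S : Set V) : Prop :=
  ∀ χ : L → K, ∃ κ : V → K, ∀ e ∈ E, ∃ g, IsHomothety f g ∧
    ∀ a, g a ∈ P ∧ π (g a) = e a ∧ (e a ∈ S → χ (g a) = κ (e a))

lemma injective_comp_of_range_eq [Finite α] {W : Type*} {e e' : α → V} {s : V → W}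
    (he : Injective (s ∘ e)) (h : Set.range e' = Set.range e) : Injective (s ∘ e') := by
  choose t ht using fun a => h ▸ Set.mem_range_self (f := e') a
  choose t' ht' using fun a => h ▸ Set.mem_range_self (f := e) a
  have hsurj : Surjective t := fun a => ⟨t' a, he.of_comp (by rw [ht, ht'])⟩
  obtain rfl : e ∘ t = e' := funext ht
  exact he.comp (Finite.injective_iff_surjective.2 hsurj)

lemma IsPicture.const_of_eq [Finite α] {E : Set (α → V)} {P : Set L} {π : L → V}
    (hP : IsPicture Q f E P π) {W : Type*} {s : V → W} (hs : ∀ e ∈ E, Injective (s ∘ e))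
    {q : α → L} (hq : IsSimilarity Q f q) (hqP : ∀ a, q a ∈ P) {a b : α} (hab : a ≠ b)
    (h : s (π (q a)) = s (π (q b))) (a' b' : α) : q a' = q b' := by
  obtain hconst | ⟨e, he, hrange⟩ := hP.const_or_edge q hq hqP
  · exact hconst a' b'
  · exact absurd (injective_comp_of_range_eq (hs e he) hrange h) hab

lemma exists_picture_insert_edge [Fintype α] (hα : 3 ≤ Fintype.card α) (hQ : Q.Anisotropic)
    (hf : Injective f) {K : Type*} {E : Set (α → V)} {P : Set L} {π : L → V}
    (hP : IsPicture Q f E P π) (harrow : PictureArrow K f E P π ∅) (e : α → V) :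
    ∃ (P' : Set L) (π' : L → V), IsPicture Q f (insert e E) P' π' ∧
      PictureArrow K f (insert e E) P' π' ∅ := by
  obtain ⟨a, b, hab⟩ := Fintype.exists_pair_of_one_lt_card (by lia : 1 < Fintype.card α)
  obtain ⟨N, hdisj, hsep⟩ := (eventually_similaritySeparated hα hQ hf hP.finite
    (Set.finite_range f) (sub_ne_zero.2 (hf.ne hab))).exists
  set c := N • (f a - f b)
  have hinj : Injective fun a => c + f a := fun a b h => hf (add_left_cancel h)
  let π' : L → V := extend (fun a => c + f a) e π
  have hπ' : ∀ a, π' (c + f a) = e a := hinj.extend_apply e π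
  have hπ'P : ∀ p ∈ P, π' p = π p := fun p hp => extend_apply' e π p fun ⟨a, ha⟩ =>
    Set.disjoint_left.1 hdisj hp ⟨f a, ⟨a, rfl⟩, ha⟩
  refine ⟨P ∪ (c +ᵥ Set.range f), π', ⟨hP.finite.union (Set.finite_range f).vadd_set, ?_⟩, ?_⟩
  · intro q hq hmem
    rcases hsep q hq hmem with hqP | hqf
    · refine (hP.const_or_edge q hq hqP).imp_right fun ⟨e', he', hrange⟩ => ⟨e', .inr he', ?_⟩
      rw [← hrange]
      exact congrArg Set.range (funext fun a => hπ'P _ (hqP a))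
    · have hcopy : ∀ a, ∃ b, q a = c + f b := fun a => by
        obtain ⟨_, ⟨b, rfl⟩, hb⟩ := hqf a
        exact ⟨b, hb.symm⟩
      choose t ht using hcopy
      refine (hq.const_or_injective hQ hf).imp_right fun hqinj => ⟨e, .inl rfl, ?_⟩
      have hsurj : Surjective t := Finite.surjective_of_injective fun a b h =>
        hqinj (by rw [ht, ht, h])
      rw [← hsurj.range_comp e]
      exact congrArg Set.range (funext fun a => by simp [ht, hπ'])
  · intro χ
    obtain ⟨κ, hκ⟩ := harrow χ
    refine ⟨κ, ?_⟩
    rintro e' (rfl | he')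
    · exact ⟨_, (IsHomothety.refl f).const_add c, fun a =>
        ⟨.inr ⟨f a, ⟨a, rfl⟩, rfl⟩, hπ' a, fun h => h.elim⟩⟩
    · obtain ⟨g, hg, hgP⟩ := hκ e' he'
      exact ⟨g, hg, fun a => ⟨.inl (hgP a).1, by rw [hπ'P _ (hgP a).1, (hgP a).2.1],
        fun h => h.elim⟩⟩

lemma exists_picture_empty [Fintype α] (hα : 3 ≤ Fintype.card α) (hQ : Q.Anisotropic)
    (hf : Injective f) (K : Type*) [Nonempty K] [Nonempty V] {E : Set (α → V)} (hE : E.Finite) :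
    ∃ (P : Set L) (π : L → V), IsPicture Q f E P π ∧ PictureArrow K f E P π ∅ := by
  induction E, hE using Set.Finite.induction_on with
  | empty =>
    have : Nonempty α := Fintype.card_pos_iff.1 (by lia)
    exact ⟨∅, fun _ => Classical.arbitrary V,
      ⟨Set.finite_empty, fun _ _ hq => (hq (Classical.arbitrary α)).elim⟩,
      fun _ => ⟨fun _ => Classical.arbitrary K, fun _ he => he.elim⟩⟩
  | insert _ _ ih =>
    obtain ⟨P, π, hP, harrow⟩ := ih
    exact exists_picture_insert_edge hα hQ hf hP harrow _

end Pictures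

section CopyWord

variable {L ι : Type*} {A : Set L} [Zero L] (h : L → L) {l m : Line A ι} {p : L}

open Classical in
/-- The word representing the point `p` in the copy of the picture indexed by the line `l`. In the
coordinates `ι` the point replaces the active variable of `l`; among the remaining coordinates only
the one indexed by `l` is nonzero, and it carries the marker `h p`. -/
noncomputable def copyWord (h : L → L) (l : Line A ι) (p : L) : ι ⊕ Line A ι → L :=
  Sum.elim (fun i => (l.idxFun i).elim p (↑)) (Pi.single l (h p))

lemma copyWord_inl_of_none {i : ι} (hi : l.idxFun i = none) : copyWord h l p (.inl i) = p := by
  simp [copyWord, hi]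

lemma copyWord_inl_of_some {i : ι} {v : A} (hi : l.idxFun i = some v) :
    copyWord h l p (.inl i) = v := by
  simp [copyWord, hi]

lemma copyWord_inl_eq_or_mem (i : ι) :
    copyWord h l p (.inl i) = p ∨ copyWord h l p (.inl i) ∈ A := by
  rcases hi : l.idxFun i with _ | v
  · exact .inl (copyWord_inl_of_none h hi)
  · exact .inr (copyWord_inl_of_some h hi ▸ v.2)

lemma copyWord_inl_mem {P : Set L} (hA : A ⊆ P) (hp : p ∈ P) (i : ι) :
    copyWord h l p (.inl i) ∈ P :=
  (copyWord_inl_eq_or_mem h i).elim (fun hi => hi ▸ hp) fun hi => hA hi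

lemma copyWord_inr_self : copyWord h l p (.inr l) = h p := by
  simp [copyWord]

lemma copyWord_inr_of_ne (hm : m ≠ l) : copyWord h l p (.inr m) = 0 := by
  simp [copyWord, hm]

lemma copyWord_inr_eq_or_eq_zero :
    copyWord h l p (.inr m) = h p ∨ copyWord h l p (.inr m) = 0 := by
  rcases eq_or_ne m l with rfl | hm
  · exact .inl (copyWord_inr_self h)
  · exact .inr (copyWord_inr_of_ne h hm)

lemma copyWord_mem_alphabet {P : Set L} (hA : A ⊆ P) (hp : p ∈ P) (j : ι ⊕ Line A ι) :
    copyWord h l p j ∈ P ∪ insert 0 (h '' P) := by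
  rcases j with i | m
  · exact .inl (copyWord_inl_mem h hA hp i)
  · exact .inr ((copyWord_inr_eq_or_eq_zero h).symm.imp id fun hm => ⟨p, hp, hm.symm⟩)

lemma eq_or_mem_of_copyWord_eq {p' : L} (heq : copyWord h l p = copyWord h m p') :
    p = p' ∨ p ∈ A := by
  obtain ⟨i, hi⟩ := l.proper
  rw [← copyWord_inl_of_none h (p := p) hi, heq]
  exact copyWord_inl_eq_or_mem h i

lemma copyWord_of_marker_eq_zero {v : A} (hv : h v = 0) :
    copyWord h l v = Sum.elim (fun i => (l v i : L)) 0 := by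
  funext j
  rcases j with i | m
  · rcases hi : l.idxFun i with _ | v' <;> simp [copyWord, hi]
  · simp [copyWord, hv]

lemma exists_eq_line_of_injective_marker {α : Type*} [Nonempty α] {l : α → Line A ι} {p : α → L}
    (hinj : Injective fun a => copyWord h (l a) (p a) (.inr m)) : ∃ c, ∀ b ≠ c, l b = m := by
  by_contra! hne
  obtain ⟨c, -, hc⟩ := hne (Classical.arbitrary α)
  obtain ⟨b, hbc, hb⟩ := hne c
  exact hbc (hinj (by simp only [copyWord_inr_of_ne h hc.symm, copyWord_inr_of_ne h hb.symm]))

end CopyWord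

section AmalgamPoint

variable {L α V ι : Type*} [AddCommGroup L] {f : α → L} {A : Set L} [Fintype ι]
  [Fintype (Line A ι)]

/-- The point carrying the word of `p` in the copy of the picture indexed by the line `l`, for the
weights `w`. The points of all the copies together form the amalgamated picture. -/
noncomputable def amalgamPoint (h : L → L) (w : ι ⊕ Line A ι → ℤ) (l : Line A ι)
    (p : L) : L :=
  ∑ j, w j • copyWord h l p j

lemma IsHomothety.amalgamPoint {h : L → L} {w : ι ⊕ Line A ι → ℤ}
    (hw : ∀ j, 0 < w j) {g : α → L} (hg : IsHomothety f g)
    (hhg : IsHomothety f (h ∘ g)) (l : Line A ι) :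
    IsHomothety f fun a => amalgamPoint h w l (g a) := by
  obtain ⟨i₀, hi₀⟩ := l.proper
  refine IsHomothety.sum_smul hw (g := fun j a => copyWord h l (g a) j) ?_ (i₀ := .inl i₀)
    (by simpa only [copyWord_inl_of_none h hi₀] using hg)
  rintro (i | m)
  · rcases hi : l.idxFun i with _ | v
    · simp only [copyWord_inl_of_none h hi]
      exact .inl hg
    · exact .inr ⟨v, fun a => copyWord_inl_of_some h hi⟩
  · rcases eq_or_ne m l with rfl | hm
    · simp only [copyWord_inr_self]
      exact .inl hhg
    · exact .inr ⟨0, fun a => copyWord_inr_of_ne h hm⟩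

lemma pictureArrow_amalgam {E : Set (α → V)} {P : Set L} {π : L → V} {x : V}
    (hA : ∀ p ∈ P, π p = x → p ∈ A) (hAx : ∀ p ∈ A, π p = x) {h : V → L}
    {w : ι ⊕ Line A ι → ℤ} {K : Type*} (hι : ∀ C : (ι → A) → K, ∃ l : Line A ι, l.IsMono C)
    {S : Set V} (harrow : PictureArrow K f E P π S) (hx : h x = 0)
    (hh : ∀ e ∈ E, IsHomothety f (h ∘ e)) (hw : ∀ j, 0 < w j) {π' : L → V}
    (hπ' : ∀ l, ∀ p ∈ P, π' (amalgamPoint (h ∘ π) w l p) = π p) :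
    PictureArrow K f E (Set.image2 (amalgamPoint (h ∘ π) w) .univ P) π' (insert x S) := by
  classical
  intro χ
  obtain ⟨l, c, hl⟩ := hι fun u => χ (∑ j, w j • Sum.elim (fun i => (u i : L)) 0 j)
  obtain ⟨κ, hκ⟩ := harrow fun p => χ (amalgamPoint (h ∘ π) w l p)
  refine ⟨update κ x c, fun e he => ?_⟩
  obtain ⟨g, hg, hgP⟩ := hκ e he
  have hmarker : h ∘ π ∘ g = h ∘ e := funext fun a => congrArg h (hgP a).2.1
  refine ⟨_, hg.amalgamPoint hw (h := h ∘ π) (hmarker ▸ hh e he) l, fun a =>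
    ⟨⟨l, trivial, _, (hgP a).1, rfl⟩, (hπ' l _ (hgP a).1).trans (hgP a).2.1, fun hea => ?_⟩⟩
  rcases eq_or_ne (e a) x with hax | hax
  · have hga : g a ∈ A := hA _ (hgP a).1 ((hgP a).2.1.trans hax)
    rw [hax, update_self, ← hl ⟨g a, hga⟩, amalgamPoint,
      copyWord_of_marker_eq_zero (h ∘ π) (v := ⟨g a, hga⟩) (by simp [hAx _ hga, hx])]
  · rw [update_of_ne hax]
    exact (hgP a).2.2 (hea.resolve_left hax)

end AmalgamPoint

section Amalgamation

variable {L α V ι : Type*} [AddCommGroup L] [Fintype α] {Q : QuadraticForm ℤ L} {f : α → L}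
  {E : Set (α → V)} {P : Set L} {π : L → V} {x : V} {h : V → L}
  {l : α → Line {p ∈ P | π p = x} ι} {p : α → L}

lemma copyWord_eq_of_marker_const (hα : 3 ≤ Fintype.card α) (hQ : Q.Anisotropic)
    (hf : Injective f) (hP : IsPicture Q f E P π) (hh : ∀ e ∈ E, Injective (h ∘ e))
    (hp : ∀ a, p a ∈ P)
    (hsim : ∀ j, IsSimilarity Q f fun a => copyWord (h ∘ π) (l a) (p a) j)
    (hconst : ∀ a b, h (π (p a)) = h (π (p b))) (a b : α) :
    copyWord (h ∘ π) (l a) (p a) = copyWord (h ∘ π) (l b) (p b) := by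
  have hmarker : ∀ c, h (π (p c)) = h (π (p a)) := fun c => hconst c a
  funext j
  rcases j with i | m
  · obtain ⟨a', b', hab, heq⟩ := exists_ne_map_eq_of_forall_eq_or_eq hα
      (g := fun c => h (π (copyWord (h ∘ π) (l c) (p c) (.inl i)))) (y := h (π (p a))) (z := h x)
      fun c => (copyWord_inl_eq_or_mem (h ∘ π) i).imp
        (fun hc => by rw [hc, hmarker]) fun hc => by rw [hc.2]
    exact hP.const_of_eq hh (hsim _)
      (fun c => copyWord_inl_mem _ (Set.sep_subset _ _) (hp c) i) hab heq a b
  · obtain ⟨a', b', hab, heq⟩ := exists_ne_map_eq_of_forall_eq_or_eq hα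
      (g := fun c => copyWord (h ∘ π) (l c) (p c) (.inr m)) (y := h (π (p a))) (z := 0)
      fun c => (copyWord_inr_eq_or_eq_zero (h ∘ π)).imp_left fun hc => hc.trans (hmarker c)
    exact (hsim _).const_of_eq hQ hf hab heq a b

lemma exists_copyWord_inl_vertex_eq (hα : 3 ≤ Fintype.card α) (hQ : Q.Anisotropic)
    (hf : Injective f) (hsim : ∀ j, IsSimilarity Q f fun a => copyWord (h ∘ π) (l a) (p a) j)
    {m : Line {p ∈ P | π p = x} ι} {c : α} (hl : ∀ b ≠ c, l b = m) :
    ∃ i, ∀ b, π (copyWord (h ∘ π) (l b) (p b) (.inl i)) = π (p b) := by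
  obtain ⟨i₁, hi₁⟩ := (l c).proper
  rcases hv : m.idxFun i₁ with _ | v
  · refine ⟨i₁, fun b => ?_⟩
    rw [copyWord_inl_of_none]
    rcases eq_or_ne b c with rfl | hbc
    · exact hi₁
    · exact hl b hbc ▸ hv
  · have hfixed : ∀ b ≠ c, copyWord (h ∘ π) (l b) (p b) (.inl i₁) = v := fun b hbc =>
      copyWord_inl_of_some _ (hl b hbc ▸ hv)
    obtain ⟨b₁, hb₁, -⟩ := exists_ne_ne hα c c
    obtain ⟨b₂, hb₂, hb₂₁⟩ := exists_ne_ne hα c b₁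
    have hpc : p c = v := by
      rw [← copyWord_inl_of_none (h ∘ π) (p := p c) hi₁, ← hfixed b₁ hb₁]
      exact (hsim (.inl i₁)).const_of_eq hQ hf hb₂₁ (by rw [hfixed b₂ hb₂, hfixed b₁ hb₁]) c b₁
    obtain ⟨i₀, hi₀⟩ := m.proper
    refine ⟨i₀, fun b => ?_⟩
    rcases eq_or_ne b c with rfl | hbc
    · rcases copyWord_inl_eq_or_mem (h ∘ π) (l := l b) (p := p b) i₀ with heq | hmem
      · rw [heq]
      · rw [hmem.2, hpc, v.2.2]
    · rw [copyWord_inl_of_none _ (hl b hbc ▸ hi₀)]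

lemma copyWord_const_or_edge (hα : 3 ≤ Fintype.card α) (hQ : Q.Anisotropic) (hf : Injective f)
    (hP : IsPicture Q f E P π) (hh : ∀ e ∈ E, Injective (h ∘ e)) (hp : ∀ a, p a ∈ P)
    (hsim : ∀ j, IsSimilarity Q f fun a => copyWord (h ∘ π) (l a) (p a) j) :
    (∀ a b, copyWord (h ∘ π) (l a) (p a) = copyWord (h ∘ π) (l b) (p b)) ∨
      ∃ e ∈ E, Set.range (π ∘ p) = Set.range e := by
  by_cases hconst : ∀ a b, h (π (p a)) = h (π (p b))
  · exact .inl (copyWord_eq_of_marker_const hα hQ hf hP hh hp hsim hconst)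
  obtain ⟨a, ha⟩ : ∃ a, h (π (p a)) ≠ 0 := by
    by_contra! hzero
    exact hconst fun a b => by rw [hzero, hzero]
  rcases (hsim (.inr (l a))).const_or_injective hQ hf with hmarker | hinj
  · have hl : ∀ b, l b = l a := fun b => by
      by_contra hb
      have heq := hmarker a b
      rw [copyWord_inr_self, copyWord_inr_of_ne _ (Ne.symm hb)] at heq
      exact ha heq
    refine absurd (fun b c => ?_) hconst
    have heq := hmarker b c
    rwa [← hl b, copyWord_inr_self, hl b, ← hl c, copyWord_inr_self] at heq
  · have : Nonempty α := ⟨a⟩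
    obtain ⟨c, hc⟩ := exists_eq_line_of_injective_marker _ hinj
    obtain ⟨i, hi⟩ := exists_copyWord_inl_vertex_eq hα hQ hf hsim hc
    obtain hci | ⟨e, he, hrange⟩ := hP.const_or_edge _ (hsim (.inl i))
      fun b => copyWord_inl_mem _ (Set.sep_subset _ _) (hp b) i
    · exact absurd (fun b c => by rw [← hi b, ← hi c, hci b c]) hconst
    · exact .inr ⟨e, he, by rw [← hrange]; exact congrArg Set.range (funext fun b => (hi b).symm)⟩

variable [Fintype ι] [Fintype (Line {p ∈ P | π p = x} ι)] {w : ι ⊕ Line {p ∈ P | π p = x} ι → ℤ}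

lemma exists_vertex_map_amalgamPoint (hα : 3 ≤ Fintype.card α) (hQ : Q.Anisotropic)
    (hf : Injective f) (hw : IsGeneric Q f (P ∪ insert 0 ((h ∘ π) '' P)) w) :
    ∃ π' : L → V, ∀ l, ∀ p ∈ P, π' (amalgamPoint (h ∘ π) w l p) = π p := by
  have hA : {p ∈ P | π p = x} ⊆ P := Set.sep_subset _ _
  have hfac : FactorsThrough (fun t : Line {p ∈ P | π p = x} ι × P => π t.2)
      fun t => amalgamPoint (h ∘ π) w t.1 t.2 := by
    rintro ⟨l, p, hp⟩ ⟨l', p', hp'⟩ heq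
    have hword := hw.eq_of_sum_smul_eq hα hQ hf (copyWord_mem_alphabet _ hA hp)
      (copyWord_mem_alphabet _ hA hp') heq
    rcases eq_or_mem_of_copyWord_eq _ hword with rfl | hpA
    · rfl
    rcases eq_or_mem_of_copyWord_eq _ hword.symm with rfl | hpA'
    · rfl
    · exact hpA.2.trans hpA'.2.symm
  exact ⟨extend _ _ fun _ => x, fun l p hp => hfac.extend_apply _ (l, ⟨p, hp⟩)⟩

lemma isPicture_amalgam (hα : 3 ≤ Fintype.card α) (hQ : Q.Anisotropic) (hf : Injective f)
    (hP : IsPicture Q f E P π) (hh : ∀ e ∈ E, Injective (h ∘ e))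
    (hw : IsGeneric Q f (P ∪ insert 0 ((h ∘ π) '' P)) w) {π' : L → V}
    (hπ' : ∀ l, ∀ p ∈ P, π' (amalgamPoint (h ∘ π) w l p) = π p) :
    IsPicture Q f E (Set.image2 (amalgamPoint (h ∘ π) w) .univ P) π' := by
  refine ⟨Set.finite_univ.image2 _ hP.finite, fun q hq hmem => ?_⟩
  choose l _ p hp hqp using hmem
  obtain rfl : (fun a => amalgamPoint (h ∘ π) w (l a) (p a)) = q := funext hqp
  have hsim := hw _ (fun a => copyWord_mem_alphabet _ (Set.sep_subset _ _) (hp a)) hq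
  refine (copyWord_const_or_edge hα hQ hf hP hh hp hsim).imp (fun hconst a b => ?_) ?_
  · exact congrArg (fun u => ∑ j, w j • u j) (hconst a b)
  · rintro ⟨e, he, hrange⟩
    exact ⟨e, he, by rw [← hrange]; exact congrArg Set.range (funext fun a => hπ' _ _ (hp a))⟩

end Amalgamation

section PartiteConstruction

variable {L α V : Type*} [AddCommGroup L] [Fintype α] {Q : QuadraticForm ℤ L} {f : α → L}
  {E : Set (α → V)} {K : Type*} [Finite K]

lemma finite_line (A ι : Type*) [Finite A] [Finite ι] : Finite (Line A ι) :=
  .of_injective (fun l => l.idxFun) fun ⟨_, _⟩ ⟨_, _⟩ h => by simpa using h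

lemma exists_picture_insert_vertex (hα : 3 ≤ Fintype.card α) (hQ : Q.Anisotropic)
    (hf : Injective f) {P : Set L} {π : L → V} {S : Set V} {s : V → L}
    (hs : ∀ e ∈ E, IsHomothety f (s ∘ e)) (hP : IsPicture Q f E P π)
    (harrow : PictureArrow K f E P π S) (x : V) :
    ∃ (P' : Set L) (π' : L → V), IsPicture Q f E P' π' ∧
      PictureArrow K f E P' π' (insert x S) := by
  let h : V → L := fun y => -s x + s y
  have hh : ∀ e ∈ E, IsHomothety f (h ∘ e) := fun e he => (hs e he).const_add (-s x)
  have : Finite {p ∈ P | π p = x} := hP.finite.subset (Set.sep_subset _ _)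
  obtain ⟨ι, _, hι⟩ := Line.exists_mono_in_high_dimension {p ∈ P | π p = x} K
  have := finite_line {p ∈ P | π p = x} ι
  have := Fintype.ofFinite (Line {p ∈ P | π p = x} ι)
  obtain ⟨w, hw0, hw⟩ := exists_isGeneric (Q := Q) (f := f) (ι ⊕ Line {p ∈ P | π p = x} ι)
    (hP.finite.union ((hP.finite.image (h ∘ π)).insert 0))
  obtain ⟨π', hπ'⟩ := exists_vertex_map_amalgamPoint hα hQ hf hw
  exact ⟨_, π', isPicture_amalgam hα hQ hf hP (fun e he => (hh e he).injective hQ hf) hw hπ',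
    pictureArrow_amalgam (A := {p ∈ P | π p = x}) (fun _ hp hx => ⟨hp, hx⟩) (fun _ hp => hp.2) hι
      harrow (neg_add_cancel _) hh hw0 hπ'⟩

lemma exists_picture_univ (hα : 3 ≤ Fintype.card α) (hQ : Q.Anisotropic) (hf : Injective f)
    [Finite V] [Nonempty V] [Nonempty K] {s : V → L} (hs : ∀ e ∈ E, IsHomothety f (s ∘ e)) :
    ∃ (P : Set L) (π : L → V), IsPicture Q f E P π ∧ PictureArrow K f E P π .univ := by
  induction (.univ : Set V), Set.finite_univ (α := V) using Set.Finite.induction_on with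
  | empty => exact exists_picture_empty hα hQ hf K E.toFinite
  | insert _ _ ih =>
    obtain ⟨P, π, hP, harrow⟩ := ih
    exact exists_picture_insert_vertex hα hQ hf hs hP harrow _

end PartiteConstruction

section Ramsey

variable {β K : Type*}

/-- All `m`-element subsets of `U` have the same colour. -/
def IsHomogeneous (χ : Finset β → K) (m : ℕ) (U : Finset β) : Prop :=
  ∃ c, ∀ A ⊆ U, A.card = m → χ A = c

/-- `N` is an upper bound for the Ramsey number of `T`-element sets homogeneous for colourings of
the `m`-element sets from `K`. -/
def IsRamseyBound (K : Type*) (m T N : ℕ) : Prop :=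
  ∀ ⦃β : Type⦄ [LinearOrder β] (S : Finset β), N ≤ S.card → ∀ χ : Finset β → K,
    ∃ U ⊆ S, U.card = T ∧ IsHomogeneous χ m U

lemma exists_min_homogeneous {m : ℕ} (hm : ∀ T, ∃ N, IsRamseyBound K m T N) (T : ℕ) :
    ∃ N, ∀ ⦃β : Type⦄ [LinearOrder β] (S : Finset β), N ≤ S.card → ∀ χ : Finset β → K,
      ∃ U ⊆ S, U.card = T ∧ ∃ g : β → K, ∀ x ∈ U, ∀ B ⊆ U, (∀ y ∈ B, x < y) → B.card = m →
        χ (insert x B) = g x := by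
  induction T with
  | zero => exact ⟨0, fun β _ S _ χ => ⟨∅, S.empty_subset, rfl, fun _ => χ ∅, by simp⟩⟩
  | succ T ih =>
    obtain ⟨N, hN⟩ := ih
    obtain ⟨M, hM⟩ := hm N
    refine ⟨M + 1, fun β _ S hS χ => ?_⟩
    have hne : S.Nonempty := Finset.card_pos.1 (by lia)
    set x := S.min' hne
    have hx : x ∈ S := S.min'_mem hne
    obtain ⟨W, hWS, hWcard, c, hc⟩ := hM (S.erase x)
      (by rw [Finset.card_erase_of_mem hx]; lia) fun B => χ (insert x B)
    obtain ⟨U, hUW, hUcard, g, hg⟩ := hN W hWcard.ge χ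
    have hxU : ∀ y ∈ U, x < y := fun y hy => S.min'_lt_of_mem_erase_min' hne (hWS (hUW hy))
    have hxU' : x ∉ U := fun h => lt_irrefl _ (hxU x h)
    refine ⟨insert x U, Finset.insert_subset hx ((hUW.trans hWS).trans (S.erase_subset x)),
      by rw [Finset.card_insert_of_notMem hxU', hUcard], update g x c, fun z hz B hB hzB hBm => ?_⟩
    have hxz : x ≤ z := (Finset.mem_insert.1 hz).elim (fun h => h.ge) fun h => (hxU z h).le
    have hBU : B ⊆ U := fun y hy => (Finset.mem_insert.1 (hB hy)).resolve_left
      (hxz.trans_lt (hzB y hy)).ne'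
    rcases Finset.mem_insert.1 hz with rfl | hzU
    · rw [update_self]
      exact hc B (hBU.trans hUW) hBm
    · rw [update_of_ne (hxU z hzU).ne']
      exact hg z hzU B hBU hzB hBm

theorem exists_isRamseyBound [Finite K] [Nonempty K] (m T : ℕ) : ∃ N, IsRamseyBound K m T N := by
  classical
  have := Fintype.ofFinite K
  induction m generalizing T with
  | zero =>
    refine ⟨T, fun β _ S hS χ => ?_⟩
    obtain ⟨U, hU, hcard⟩ := Finset.exists_subset_card_eq hS
    exact ⟨U, hU, hcard, χ ∅, fun A _ hA => by rw [Finset.card_eq_zero.1 hA]⟩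
  | succ m ih =>
    obtain ⟨N, hN⟩ := exists_min_homogeneous ih (Fintype.card K * T)
    refine ⟨N, fun β _ S hS χ => ?_⟩
    obtain ⟨W, hWS, hWcard, g, hg⟩ := hN S hS χ
    obtain ⟨c, -, hc⟩ := Finset.exists_le_card_fiber_of_mul_le_card_of_maps_to
      (f := g) (s := W) (t := Finset.univ) (n := T) (fun _ _ => Finset.mem_univ _)
      Finset.univ_nonempty (by simp [hWcard])
    obtain ⟨U, hU, hUcard⟩ := Finset.exists_subset_card_eq hc
    have hUW : U ⊆ W := hU.trans (W.filter_subset _)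
    refine ⟨U, hUW.trans hWS, hUcard, c, fun A hA hAm => ?_⟩
    have hne : A.Nonempty := Finset.card_pos.1 (by lia)
    have hmin : A.min' hne ∈ U := hA (A.min'_mem hne)
    rw [← Finset.insert_erase (A.min'_mem hne), hg _ (hUW hmin) _
      ((A.erase_subset _).trans (hA.trans hUW)) (fun y => A.min'_lt_of_mem_erase_min' hne)
      (by rw [Finset.card_erase_of_mem (A.min'_mem hne), hAm, Nat.add_sub_cancel])]
    exact (Finset.mem_filter.1 (hU hmin)).2

end Ramsey

section Windows

variable {m k : ℕ} {β : Type*}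

/-- The window of length `m` starting at position `j` of a sequence. -/
def window (U : Fin (m + k) ↪ β) (j : Fin k) : Fin m ↪ β where
  toFun t := U ⟨t + j, by lia⟩
  inj' a b h := by
    have := U.injective h
    simp only [Fin.mk.injEq] at this
    exact Fin.ext (by lia)

lemma window_apply (U : Fin (m + k) ↪ β) (j : Fin k) (t : Fin m) :
    window U j t = U ⟨t + j, by lia⟩ := rfl

lemma exists_mono_windows (K : Type*) [Finite K] [Nonempty K] (m k : ℕ) :
    ∃ N, ∀ χ : (Fin m ↪ Fin N) → K,
      ∃ (U : Fin (m + k) ↪ Fin N) (c : K), ∀ j, χ (window U j) = c := by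
  classical
  obtain ⟨N, hN⟩ := exists_isRamseyBound (K := K) m (m + k)
  refine ⟨N, fun χ => ?_⟩
  obtain ⟨S, -, hS, c, hc⟩ := hN (.univ : Finset (Fin N)) (by simp) fun A =>
    if h : A.card = m then χ (A.orderEmbOfFin h).toEmbedding else Classical.arbitrary K
  refine ⟨(S.orderEmbOfFin hS).toEmbedding, c, fun j => ?_⟩
  set W := window (S.orderEmbOfFin hS).toEmbedding j
  have hmono : StrictMono W := fun a b hab => (S.orderEmbOfFin hS).strictMono
    (Fin.mk_lt_mk.2 (Nat.add_lt_add_right hab _))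
  have hsub : Finset.univ.map W ⊆ S := fun y hy => by
    obtain ⟨t, -, rfl⟩ := Finset.mem_map.1 hy
    exact S.orderEmbOfFin_mem hS _
  have hcard : (Finset.univ.map W).card = m := by simp
  have hW := hc _ hsub hcard
  simp only [dif_pos hcard] at hW
  rw [← hW]
  congr 1
  ext t : 1
  exact congrFun (Finset.orderEmbOfFin_unique hcard
    (fun t => Finset.mem_map_of_mem W (Finset.mem_univ t)) hmono) t

end Windows

section Peaks

variable {m k : ℕ} {β τ : Type*} [LinearOrder β] [Fintype β] [Fintype τ]

/-- The rankings `σ` of `β` for which the family `W` takes its largest value at the index `t`. -/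
def peakPerms (W : τ ↪ β) (t : τ) : Finset (Equiv.Perm β) :=
  {σ | ∀ t', σ (W t') ≤ σ (W t)}

lemma mem_peakPerms {W : τ ↪ β} {t : τ} {σ : Equiv.Perm β} :
    σ ∈ peakPerms W t ↔ ∀ t', σ (W t') ≤ σ (W t) := by
  simp [peakPerms]

lemma card_peakPerms_eq (W : τ ↪ β) (t u : τ) : (peakPerms W t).card = (peakPerms W u).card := by
  classical
  refine Finset.card_equiv (Equiv.mulRight (Equiv.swap (W t) (W u))) fun σ => ?_
  simp only [mem_peakPerms, Equiv.coe_mulRight, Equiv.Perm.mul_apply, Equiv.swap_apply_right,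
    ← W.injective.map_swap]
  exact (Equiv.swap t u).forall_congr_left.trans (by simp)

lemma pairwiseDisjoint_peakPerms (W : τ ↪ β) (G : Set τ) : G.PairwiseDisjoint (peakPerms W) := by
  refine fun t _ u _ htu => Finset.disjoint_left.2 fun σ ht hu => htu ?_
  rw [mem_peakPerms] at ht hu
  exact W.injective (σ.injective (le_antisymm (hu t) (ht u)))

lemma card_mul_card_biUnion_peakPerms [Nonempty τ] (W : τ ↪ β) (G : Finset τ) :
    Fintype.card τ * (G.biUnion (peakPerms W)).card =
      G.card * Fintype.card (Equiv.Perm β) := by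
  let t₀ := Classical.arbitrary τ
  have hcard : ∀ G : Finset τ,
      (G.biUnion (peakPerms W)).card = G.card * (peakPerms W t₀).card := fun G => by
    rw [Finset.card_biUnion (pairwiseDisjoint_peakPerms W _),
      Finset.sum_congr rfl fun t _ => card_peakPerms_eq W t t₀, Finset.sum_const, smul_eq_mul]
  have huniv : Finset.univ.biUnion (peakPerms W) = .univ := Finset.eq_univ_of_forall fun σ => by
    simpa [mem_peakPerms] using Finite.exists_max fun t => σ (W t)
  rw [← Finset.card_univ (α := Equiv.Perm β), ← huniv, hcard, hcard, Finset.card_univ]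
  ring

/-- The positions in a window of length `m` at distance at least `k` from its right end and not
divisible by `k`. -/
def goodPositions (m k : ℕ) : Finset (Fin m) :=
  {t | t + k ≤ m ∧ ¬ k ∣ t}

/-- The rankings of `β` for which the window `W` has its peak at a good position. -/
def goodPeakPerms (k : ℕ) (W : Fin m ↪ β) : Finset (Equiv.Perm β) :=
  (goodPositions m k).biUnion (peakPerms W)

lemma mem_goodPeakPerms {σ : Equiv.Perm β} {W : Fin m ↪ β} : σ ∈ goodPeakPerms k W ↔
    ∃ t : Fin m, (t + k ≤ m ∧ ¬ k ∣ t) ∧ ∀ t', σ (W t') ≤ σ (W t) := by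
  simp [goodPeakPerms, goodPositions, mem_peakPerms]

lemma exists_notMem_goodPeakPerms_window (hk : 0 < k) (σ : Equiv.Perm β)
    (U : Fin (m + k) ↪ β) : ∃ j, σ ∉ goodPeakPerms k (window U j) := by
  by_contra! hall
  obtain ⟨t₀, ⟨ht₀, -⟩, hmax₀⟩ := mem_goodPeakPerms.1 (hall ⟨0, hk⟩)
  obtain ⟨t, ⟨ht, hdvd⟩, hmax⟩ := mem_goodPeakPerms.1 (hall ⟨t₀ % k, Nat.mod_lt _ hk⟩)
  have hlt := Nat.mod_lt (t₀ : ℕ) hk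
  have hle := Nat.mod_le (t₀ : ℕ) k
  have hle₀ := hmax₀ ⟨t + t₀ % k, by lia⟩
  have hge₀ := hmax ⟨t₀ - t₀ % k, by lia⟩
  simp only [window_apply, add_zero, Nat.sub_add_cancel hle] at hle₀ hge₀
  have hpos : (t : ℕ) + t₀ % k = t₀ := by
    simpa using U.injective (σ.injective (le_antisymm hle₀ hge₀))
  exact hdvd (Nat.eq_sub_of_add_eq hpos ▸ Nat.dvd_sub_mod _)

lemma card_goodPositions_ge (M : ℕ) (hk : 0 < k) :
    M * (k - 1) ≤ (goodPositions (k * (M + 1)) k).card := by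
  have hcount : ((Finset.Ioc 0 (k * M)).filter (¬ k ∣ ·)).card = M * (k - 1) := by
    have hsplit := Finset.card_filter_add_card_filter_not (s := Finset.Ioc 0 (k * M)) (k ∣ ·)
    rw [Nat.Ioc_filter_dvd_card_eq_div, Nat.mul_div_cancel_left _ hk, Nat.card_Ioc] at hsplit
    rw [Nat.mul_sub_one, mul_comm M k]
    lia
  rw [← hcount]
  refine Finset.card_le_card_of_surjOn (fun t : Fin _ => (t : ℕ)) fun t ht => ?_
  simp only [Finset.coe_filter, Finset.mem_Ioc, Set.mem_ofPred_eq] at ht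
  refine ⟨⟨t, by lia⟩, ?_, rfl⟩
  simpa [goodPositions, mul_add, ht.2] using ht.1.2

lemma exists_dense_goodPositions {μ : ℝ} (hk : 0 < k) (hμ : μ < ((k : ℝ) - 1) / k) :
    ∃ m, 0 < m ∧ μ * m ≤ (goodPositions m k).card := by
  rw [lt_div_iff₀ (by positivity)] at hμ
  obtain ⟨M, hM⟩ := exists_nat_ge (μ * k / ((k : ℝ) - 1 - μ * k))
  rw [div_le_iff₀ (by linarith)] at hM
  refine ⟨k * (M + 1), by positivity, ?_⟩
  have hcard : (M : ℝ) * ((k : ℝ) - 1) ≤ (goodPositions (k * (M + 1)) k).card := by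
    rw [← Nat.cast_pred hk]
    exact_mod_cast card_goodPositions_ge M hk
  push_cast
  linarith

lemma exists_dense_goodPeakPerms {μ : ℝ} (hk : 0 < k) (hμ : μ < ((k : ℝ) - 1) / k) :
    ∃ m, ∀ (β : Type) [LinearOrder β] [Fintype β] (W : Fin m ↪ β),
      μ * Fintype.card (Equiv.Perm β) ≤ (goodPeakPerms k W).card := by
  obtain ⟨m, hm, hdense⟩ := exists_dense_goodPositions hk hμ
  refine ⟨m, fun β _ _ W => ?_⟩
  have : Nonempty (Fin m) := ⟨⟨0, hm⟩⟩
  have hcard : (m : ℝ) * (goodPeakPerms k W).card =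
      (goodPositions m k).card * Fintype.card (Equiv.Perm β) := by
    simpa [goodPeakPerms] using
      congrArg (Nat.cast (R := ℝ)) (card_mul_card_biUnion_peakPerms W (goodPositions m k))
  refine le_of_mul_le_mul_left ?_ (Nat.cast_pos.2 hm : (0 : ℝ) < m)
  rw [hcard, mul_left_comm, ← mul_assoc]
  exact mul_le_mul_of_nonneg_right hdense (Nat.cast_nonneg _)

lemma exists_dense_ramsey_hypergraph {μ : ℝ} (hk : 0 < k) (hμ : μ < ((k : ℝ) - 1) / k)
    (K : Type*) [Finite K] [Nonempty K] :
    ∃ (W Ω : Type) (_ : Finite W) (_ : Fintype Ω) (_ : Nonempty Ω) (E : Set (Fin k → W))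
      (G : W → Finset Ω), (∀ χ : W → K, ∃ e ∈ E, ∃ c, ∀ j, χ (e j) = c) ∧
      (∀ w, μ * Fintype.card Ω ≤ (G w).card) ∧ ∀ ω, ∀ e ∈ E, ∃ j, ω ∉ G (e j) := by
  obtain ⟨m, hm⟩ := exists_dense_goodPeakPerms hk hμ
  obtain ⟨N, hN⟩ := exists_mono_windows K m k
  refine ⟨Fin m ↪ Fin N, Equiv.Perm (Fin N), inferInstance, _, inferInstance, .range window,
    goodPeakPerms k, fun χ => ?_, hm (Fin N), ?_⟩
  · obtain ⟨U, hU⟩ := hN χ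
    exact ⟨window U, ⟨U, rfl⟩, hU⟩
  · rintro σ _ ⟨U, rfl⟩
    exact exists_notMem_goodPeakPerms_window hk σ U

end Peaks

section Fractional

variable {L α V : Type*} [AddCommGroup L] {Q : QuadraticForm ℤ L} {f : α → L} {μ : ℝ}

/-- Every similar copy of `f` in `Z` is degenerate. -/
def SimilarityFree (Q : QuadraticForm ℤ L) (f : α → L) (Z : Set L) : Prop :=
  ∀ q, IsSimilarity Q f q → (∀ a, q a ∈ Z) → ∀ a b, q a = q b

/-- Every finite subset of `A` has a subset of relative density at least `μ` without nondegenerate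
similar copies of `f`. -/
def SimilarityFractional (Q : QuadraticForm ℤ L) (f : α → L) (μ : ℝ) (A : Set L) : Prop :=
  ∀ Y : Finset L, ↑Y ⊆ A → ∃ Z ⊆ Y, SimilarityFree Q f Z ∧ μ * Y.card ≤ Z.card

lemma SimilaritySeparated.similarityFree_union {A B Z W : Set L}
    (hAB : SimilaritySeparated Q f A B) (hZA : Z ⊆ A) (hWB : W ⊆ B) (hZ : SimilarityFree Q f Z)
    (hW : SimilarityFree Q f W) : SimilarityFree Q f (Z ∪ W) := by
  intro q hq hmem
  rcases hAB.2 q hq fun a => Set.union_subset_union hZA hWB (hmem a) with h | h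
  · exact hZ q hq fun a => (hmem a).resolve_right fun ha =>
      Set.disjoint_left.1 hAB.1 (h a) (hWB ha)
  · exact hW q hq fun a => (hmem a).resolve_left fun ha =>
      Set.disjoint_left.1 hAB.1 (hZA ha) (h a)

lemma SimilarityFractional.union {A B : Set L} (hAB : SimilaritySeparated Q f A B)
    (hA : SimilarityFractional Q f μ A) (hB : SimilarityFractional Q f μ B) :
    SimilarityFractional Q f μ (A ∪ B) := by
  classical
  intro Y hY
  obtain ⟨Z, hZY, hZ, hZcard⟩ := hA (Y.filter (· ∈ A)) fun y hy => (Finset.mem_filter.1 hy).2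
  obtain ⟨W, hWY, hW, hWcard⟩ := hB (Y.filter (· ∉ A)) fun y hy =>
    (hY (Finset.mem_filter.1 hy).1).resolve_left (Finset.mem_filter.1 hy).2
  have hZA : (Z : Set L) ⊆ A := fun z hz => (Finset.mem_filter.1 (hZY hz)).2
  have hWB : (W : Set L) ⊆ B := fun w hw =>
    (hY (Finset.mem_filter.1 (hWY hw)).1).resolve_left (Finset.mem_filter.1 (hWY hw)).2
  have hdisj : Disjoint Z W := Finset.disjoint_coe.1 (hAB.1.mono hZA hWB)
  refine ⟨Z ∪ W, Finset.union_subset (hZY.trans (Y.filter_subset _))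
    (hWY.trans (Y.filter_subset _)), ?_, ?_⟩
  · rw [Finset.coe_union]
    exact hAB.similarityFree_union hZA hWB hZ hW
  · rw [Finset.card_union_of_disjoint hdisj,
      ← Finset.card_filter_add_card_filter_not (s := Y) (· ∈ A)]
    push_cast
    linarith

lemma SimilarityFractional.vadd {A : Set L} (hA : SimilarityFractional Q f μ A) (c : L) :
    SimilarityFractional Q f μ (c +ᵥ A) := by
  classical
  intro Y hY
  obtain ⟨Z, hZY, hZ, hcard⟩ := hA (-c +ᵥ Y) (by
    rwa [Finset.coe_vadd_finset, Set.vadd_set_subset_iff_subset_neg_vadd_set, neg_neg])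
  refine ⟨c +ᵥ Z, ?_, fun q hq hqZ a b => ?_, ?_⟩
  · rwa [Finset.vadd_finset_subset_iff]
  · refine add_left_cancel (hZ (fun a => -c + q a) ((isSimilarity_const_add_iff _).2 hq)
      (fun a => ?_) a b)
    rw [← vadd_eq_add, Finset.mem_coe, ← Finset.mem_neg_vadd_finset_iff, neg_neg]
    exact hqZ a
  · simpa using hcard

lemma SimilarityFractional.iUnion {A : ℕ → Set L} (hmono : Monotone A)
    (hA : ∀ n, SimilarityFractional Q f μ (A n)) : SimilarityFractional Q f μ (⋃ n, A n) := by
  intro Y hY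
  obtain ⟨n, hn⟩ := hmono.directed_le.exists_mem_subset_of_finset_subset_biUnion hY
  exact hA n Y hn

lemma IsPicture.similarityFractional {E : Set (α → V)} {P : Set L} {π : L → V} {Ω : Type*}
    [Fintype Ω] [Nonempty Ω] {G : V → Finset Ω} (hP : IsPicture Q f E P π)
    (hG : ∀ v, μ * Fintype.card Ω ≤ (G v).card) (hE : ∀ ω, ∀ e ∈ E, ∃ a, ω ∉ G (e a)) :
    SimilarityFractional Q f μ P := by
  classical
  intro Y hY
  obtain ⟨ω, -, hω⟩ : ∃ ω ∈ (.univ : Finset Ω),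
      μ * Y.card ≤ ((Y.filter fun y => ω ∈ G (π y)).card : ℝ) := by
    refine Finset.exists_le_of_sum_le Finset.univ_nonempty ?_
    calc ∑ _ω : Ω, μ * (Y.card : ℝ) = ∑ _y ∈ Y, μ * Fintype.card Ω := by
          simp only [Finset.sum_const, nsmul_eq_mul, Finset.card_univ]
          ring
      _ ≤ ∑ y ∈ Y, ((G (π y)).card : ℝ) := Finset.sum_le_sum fun y _ => hG (π y)
      _ = ∑ ω : Ω, ((Y.filter fun y => ω ∈ G (π y)).card : ℝ) := by
          have hcount := Finset.sum_card_bipartiteAbove_eq_sum_card_bipartiteBelow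
            (s := (.univ : Finset Ω)) (t := Y) fun ω y => ω ∈ G (π y)
          simp only [Finset.bipartiteAbove, Finset.bipartiteBelow, Finset.filter_univ_mem] at hcount
          exact_mod_cast hcount.symm
  refine ⟨_, Y.filter_subset _, fun q hq hqZ => ?_, hω⟩
  refine (hP.const_or_edge q hq fun a => hY (Finset.mem_filter.1 (hqZ a)).1).resolve_right ?_
  rintro ⟨e, he, hrange⟩
  obtain ⟨a, ha⟩ := hE ω e he
  obtain ⟨b, hb⟩ := hrange ▸ Set.mem_range_self (f := e) a
  exact ha (hb ▸ (Finset.mem_filter.1 (hqZ b)).2)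

end Fractional

section HomothetyArrow

variable {L α K : Type*} [AddCommGroup L] {Q : QuadraticForm ℤ L} {f : α → L}

/-- Every colouring of `A` from `K` has a monochromatic homothetic copy of `f`. -/
def HomothetyArrow (K : Type*) (f : α → L) (A : Set L) : Prop :=
  ∀ χ : L → K, ∃ g, IsHomothety f g ∧ (∀ a, g a ∈ A) ∧ ∃ c, ∀ a, χ (g a) = c

lemma HomothetyArrow.mono {A B : Set L} (hA : HomothetyArrow K f A) (hAB : A ⊆ B) :
    HomothetyArrow K f B := fun χ =>
  let ⟨g, hg, hgA, hmono⟩ := hA χ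
  ⟨g, hg, fun a => hAB (hgA a), hmono⟩

lemma HomothetyArrow.vadd {A : Set L} (hA : HomothetyArrow K f A) (c : L) :
    HomothetyArrow K f (c +ᵥ A) := fun χ =>
  let ⟨_, hg, hgA, hmono⟩ := hA fun x => χ (c + x)
  ⟨_, hg.const_add c, fun a => Set.vadd_mem_vadd_set (hgA a), hmono⟩

lemma isHomothety_sum_line {ι : Type*} [Fintype ι] (f : α → L) (l : Line α ι) :
    IsHomothety f fun a => ∑ i, f (l a i) := by
  obtain ⟨i₀, hi₀⟩ := l.proper
  have hsum := IsHomothety.sum_smul (f := f) (w := fun _ : ι => 1) (fun _ => one_pos)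
    (g := fun i a => f (l a i)) (i₀ := i₀)
    (fun i => by
      rcases hi : l.idxFun i with _ | b
      · exact .inl (by simpa only [l.apply_none _ _ hi] using IsHomothety.refl f)
      · exact .inr ⟨f b, fun a => by rw [l.apply_some hi]⟩)
    (by simpa only [l.apply_none _ _ hi₀] using IsHomothety.refl f)
  simpa only [one_smul] using hsum

variable [Fintype α] {μ : ℝ}

lemma exists_similarityFractional_arrow (hα : 3 ≤ Fintype.card α) (hQ : Q.Anisotropic)
    (hf : Injective f) (hμ : μ < ((Fintype.card α : ℝ) - 1) / Fintype.card α) (K : Type*)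
    [Finite K] [Nonempty K] :
    ∃ A : Set L, A.Finite ∧ SimilarityFractional Q f μ A ∧ HomothetyArrow K f A := by
  have hcard : 0 < Fintype.card α := by lia
  obtain ⟨W, Ω, _, _, _, H, G, hH, hG, hHG⟩ := exists_dense_ramsey_hypergraph hcard hμ K
  obtain ⟨ι, _, hι⟩ := Line.exists_mono_in_high_dimension α (W → K)
  let idx := Fintype.equivFin α
  let E : Set (α → (ι → α) × W) :=
    {e | ∃ (l : Line α ι), ∃ h ∈ H, e = fun a => (l a, h (idx a))}
  have hs : ∀ e ∈ E, IsHomothety f ((fun x => ∑ i, f (x.1 i)) ∘ e) := by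
    rintro _ ⟨l, h, -, rfl⟩
    exact isHomothety_sum_line f l
  have : Nonempty ((ι → α) × W) :=
    let ⟨h, _⟩ := hH fun _ => Classical.arbitrary K
    ⟨fun _ => idx.symm ⟨0, hcard⟩, h ⟨0, hcard⟩⟩
  obtain ⟨P, π, hP, harrow⟩ := exists_picture_univ (K := K) hα hQ hf hs
  refine ⟨P, hP.finite, hP.similarityFractional (G := fun x => G x.2) (fun x => hG x.2) ?_,
    fun χ => ?_⟩
  · rintro ω _ ⟨l, h, hh, rfl⟩
    obtain ⟨j, hj⟩ := hHG ω h hh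
    exact ⟨idx.symm j, by simpa using hj⟩
  · obtain ⟨κ, hκ⟩ := harrow χ
    obtain ⟨l, c, hl⟩ := hι fun x w => κ (x, w)
    obtain ⟨h, hh, c₀, hc₀⟩ := hH c
    obtain ⟨g, hg, hgP⟩ := hκ _ ⟨l, h, hh, rfl⟩
    refine ⟨g, hg, fun a => (hgP a).1, c₀, fun a => ?_⟩
    rw [(hgP a).2.2 trivial, ← hc₀ (idx a), ← hl a]

lemma exists_similarityFractional_arrow_superset (hα : 3 ≤ Fintype.card α) (hQ : Q.Anisotropic)
    (hf : Injective f) (hμ : μ < ((Fintype.card α : ℝ) - 1) / Fintype.card α) (K : Type*)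
    [Finite K] [Nonempty K] {U : Set L} {v : L} (hv : v ≠ 0)
    (hU : ∀ y, ∀ᶠ N : ℤ in atTop, N • v + y ∈ U) {A : Set L} (hA : A.Finite) (hAU : A ⊆ U)
    (hAμ : SimilarityFractional Q f μ A) :
    ∃ B, A ⊆ B ∧ B.Finite ∧ B ⊆ U ∧ SimilarityFractional Q f μ B ∧ HomothetyArrow K f B := by
  obtain ⟨B, hB, hBμ, hBK⟩ := exists_similarityFractional_arrow hα hQ hf hμ K
  obtain ⟨N, hsep, hNU⟩ := ((eventually_similaritySeparated hα hQ hf hA hB hv).and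
    ((Filter.eventually_all_finite hB).2 fun y _ => hU y)).exists
  refine ⟨A ∪ (N • v +ᵥ B), Set.subset_union_left, hA.union hB.vadd_set, Set.union_subset hAU ?_,
    hAμ.union hsep (hBμ.vadd _), (hBK.vadd _).mono Set.subset_union_right⟩
  rintro _ ⟨y, hy, rfl⟩
  exact hNU y hy

lemma exists_similarityFractional_chain (hα : 3 ≤ Fintype.card α) (hQ : Q.Anisotropic)
    (hf : Injective f) (hμ : μ < ((Fintype.card α : ℝ) - 1) / Fintype.card α)
    {U : Set L} {v : L} (hv : v ≠ 0) (hU : ∀ y, ∀ᶠ N : ℤ in atTop, N • v + y ∈ U) :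
    ∃ A : ℕ → Set L, Monotone A ∧
      ∀ n, A n ⊆ U ∧ SimilarityFractional Q f μ (A n) ∧
        HomothetyArrow (Fin (n + 1)) f (A (n + 1)) := by
  let T := {A : Set L // A.Finite ∧ A ⊆ U ∧ SimilarityFractional Q f μ A}
  have hstep : ∀ (n : ℕ) (A : T), ∃ B : T, A.1 ⊆ B.1 ∧ HomothetyArrow (Fin (n + 1)) f B.1 :=
    fun n ⟨A, hA, hAU, hAμ⟩ =>
      let ⟨B, hAB, hB, hBU, hBμ, hBn⟩ := exists_similarityFractional_arrow_superset
        hα hQ hf hμ (Fin (n + 1)) hv hU hA hAU hAμ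
      ⟨⟨B, hB, hBU, hBμ⟩, hAB, hBn⟩
  choose next hsub harrow using hstep
  obtain ⟨B, hB, hBU, hBμ⟩ : T := by
    refine ⟨∅, Set.finite_empty, U.empty_subset, fun Y hY => ⟨∅, Y.empty_subset, ?_, ?_⟩⟩
    · have : Nonempty α := Fintype.card_pos_iff.1 (by lia)
      exact fun q _ hq => absurd (hq (Classical.arbitrary α)) (Finset.notMem_empty _)
    · simp [Finset.coe_eq_empty.1 (Set.subset_empty_iff.1 hY)]
  let A : ℕ → T := fun n => Nat.rec ⟨B, hB, hBU, hBμ⟩ next n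
  exact ⟨fun n => (A n).1, monotone_nat_of_le_succ fun n => hsub n (A n),
    fun n => ⟨(A n).2.2.1, (A n).2.2.2, harrow n (A n)⟩⟩

theorem theorem1p5_general (hα : 3 ≤ Fintype.card α) (hQ : Q.Anisotropic) (hf : Injective f)
    (hμ : μ < ((Fintype.card α : ℝ) - 1) / Fintype.card α) {U : Set L} {v : L}
    (hU : ∀ y, ∀ᶠ N : ℤ in atTop, N • v + y ∈ U) :
    ∃ X ⊆ U, (∀ r, 1 ≤ r → HomothetyArrow (Fin r) f X) ∧ SimilarityFractional Q f μ X := by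
  obtain ⟨v', hv', hU'⟩ : ∃ v' ≠ 0, ∀ y, ∀ᶠ N : ℤ in atTop, N • v' + y ∈ U := by
    obtain ⟨a, b, hab⟩ := Fintype.exists_pair_of_one_lt_card (by lia : 1 < Fintype.card α)
    rcases ne_or_eq v 0 with hv | rfl
    · exact ⟨v, hv, hU⟩
    · have huniv : ∀ y, y ∈ U := fun y => by simpa using (hU y).exists
      exact ⟨f a - f b, sub_ne_zero.2 (hf.ne hab), fun y => .of_forall fun N => huniv _⟩
  obtain ⟨A, hmono, hA⟩ := exists_similarityFractional_chain hα hQ hf hμ hv' hU'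
  refine ⟨⋃ n, A n, Set.iUnion_subset fun n => (hA n).1, fun r hr => ?_,
    .iUnion hmono fun n => (hA n).2.1⟩
  obtain ⟨n, rfl⟩ := Nat.exists_eq_add_of_le' hr
  exact (hA n).2.2.mono (Set.subset_iUnion A _)

end HomothetyArrow

section Lattice

variable {d : ℕ}

/-- The squared Euclidean length on `ℤ^d`. -/
def latticeNormSq (d : ℕ) : QuadraticForm ℤ (Fin d → ℤ) :=
  QuadraticMap.pi fun _ => QuadraticMap.sq

lemma latticeNormSq_apply (x : Fin d → ℤ) : latticeNormSq d x = ∑ i, x i * x i := by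
  simp [latticeNormSq]

lemma anisotropic_latticeNormSq (d : ℕ) : (latticeNormSq d).Anisotropic := by
  intro x hx
  rw [latticeNormSq_apply, Finset.sum_eq_zero_iff_of_nonneg fun i _ => mul_self_nonneg _] at hx
  exact funext fun i => mul_self_eq_zero.1 (hx i (Finset.mem_univ i))

lemma dist_latticeToEuclidean_sq (x y : Fin d → ℤ) :
    dist (latticeToEuclidean x) (latticeToEuclidean y) ^ 2 = latticeNormSq d (x - y) := by
  rw [EuclideanSpace.dist_eq, Real.sq_sqrt (Finset.sum_nonneg fun _ _ => sq_nonneg _)]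
  simp [latticeToEuclidean, latticeNormSq_apply, Real.dist_eq, sq]

lemma SimilarityFree.isConfigFree {α : Type*} [Nontrivial α] {f : α → Fin d → ℤ}
    (hf : Injective f) {Z : Set (Fin d → ℤ)} (hZ : SimilarityFree (latticeNormSq d) f Z) :
    IsConfigFree (Set.range f) Z := by
  rintro ⟨c, hc, W, hW, e, he⟩
  let p (a : α) : ↑(c • (latticeToEuclidean '' Set.range f)) :=
    ⟨c • latticeToEuclidean (f a), Set.smul_mem_smul_set ⟨f a, ⟨a, rfl⟩, rfl⟩⟩
  choose q hqZ hq using fun a => hW (e.symm (p a)).2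
  have hdist : ∀ a b, (latticeNormSq d (q a - q b) : ℝ) = c ^ 2 * latticeNormSq d (f a - f b) := by
    intro a b
    have hpair : dist (e.symm (p a) : EuclideanSpace ℝ (Fin d)) (e.symm (p b)) =
        dist (p a : EuclideanSpace ℝ (Fin d)) (p b) := by
      simpa using he.dist_eq (e.symm (p a)) (e.symm (p b))
    rw [← dist_latticeToEuclidean_sq, hq, hq, hpair, dist_smul₀, mul_pow,
      dist_latticeToEuclidean_sq, Real.norm_eq_abs, sq_abs]
  have hsim : IsSimilarity (latticeNormSq d) f q := fun a b a' b' => by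
    rify
    rw [hdist, hdist]
    ring
  obtain ⟨a, b, hab⟩ := exists_pair_ne α
  have hzero := hdist a b
  rw [hZ q hsim hqZ a b, sub_self, map_zero, Int.cast_zero, eq_comm] at hzero
  have hnorm : latticeNormSq d (f a - f b) = 0 := by simpa [hc] using hzero
  exact hab (hf (sub_eq_zero.1 (anisotropic_latticeNormSq d _ hnorm)))

lemma HomothetyArrow.exists_isHomotheticCopy {α K : Type*} [Nonempty K] {f : α → Fin d → ℤ}
    {X : Set (Fin d → ℤ)} (hX : HomothetyArrow K f X) (χ : X → K) :
    ∃ F', IsHomotheticCopy (Set.range f) F' ∧ F' ⊆ X ∧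
      ∃ c, ∀ x : X, (x : Fin d → ℤ) ∈ F' → χ x = c := by
  obtain ⟨g, ⟨v, l, hl, hg⟩, hgX, c, hc⟩ := hX (extend Subtype.val χ fun _ => Classical.arbitrary K)
  refine ⟨Set.range g, ⟨v, l, hl, ?_⟩, Set.range_subset_iff.2 hgX, c, ?_⟩
  · rw [← Set.range_comp]
    exact congrArg Set.range (funext hg)
  · rintro x ⟨a, ha⟩
    rw [← hc a, ha, Subtype.val_injective.extend_apply]

lemma eventually_forall_pos_smul_one_add (y : Fin d → ℤ) :
    ∀ᶠ N : ℤ in atTop, N • (1 : Fin d → ℤ) + y ∈ {x | ∀ i, 0 < x i} := by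
  simp only [Set.mem_ofPred_eq, eventually_all]
  intro i
  filter_upwards [eventually_gt_atTop (-y i)] with N hN
  simpa using neg_lt_iff_pos_add.1 hN

end Lattice

theorem theorem1p5 (d k : ℕ) (hk : 3 ≤ k) (F : Finset (Fin d → ℤ)) (hF : F.card = k)
    (μ : ℝ) (hμ0 : 0 < μ) (hμ1 : μ < ((k : ℝ) - 1) / (k : ℝ)) :
    ∃ X : Set (Fin d → ℤ),
      (∀ x ∈ X, ∀ i, 0 < x i) ∧
      (∀ r : ℕ, 1 ≤ r → ∀ χ : X → Fin r,
        ∃ F' : Set (Fin d → ℤ), IsHomotheticCopy (F : Set (Fin d → ℤ)) F' ∧ F' ⊆ X ∧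
          ∃ a : Fin r, ∀ x : X, (x : Fin d → ℤ) ∈ F' → χ x = a) ∧
      (∀ Y : Finset (Fin d → ℤ), (Y : Set (Fin d → ℤ)) ⊆ X →
        ∃ Z : Finset (Fin d → ℤ), Z ⊆ Y ∧
          IsConfigFree (F : Set (Fin d → ℤ)) (Z : Set (Fin d → ℤ)) ∧
          μ * (Y.card : ℝ) ≤ (Z.card : ℝ)) := by
  subst hF
  rw [← Fintype.card_coe] at hk hμ1
  have : Nontrivial F := Fintype.one_lt_card_iff_nontrivial.1 (by lia)
  rw [← Subtype.range_coe (s := (F : Set (Fin d → ℤ)))]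
  obtain ⟨X, hX, harrow, hfrac⟩ := theorem1p5_general hk (anisotropic_latticeNormSq d)
    Subtype.val_injective hμ1 eventually_forall_pos_smul_one_add
  refine ⟨X, hX, fun r hr => ?_, fun Y hY => ?_⟩
  · have : NeZero r := ⟨by lia⟩
    exact (harrow r hr).exists_isHomotheticCopy
  · obtain ⟨Z, hZY, hZ, hcard⟩ := hfrac Y hY
    exact ⟨Z, hZY, hZ.isConfigFree Subtype.val_injective, hcard⟩
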